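/- Let $g(x) := 2\int_0^{\infty} \cos(2\pi u x)\prod_{n=1}^{\infty}\cos(2\pi u/n)\,\mathrm{d}u$ for $x \in \mathbb{R}$, and for $N \in \mathbb{N}$ and $\tau \in \mathbb{R}$ let $\mathfrak{m}_N(\tau) := \min\left\{\left|\sum_{n=1}^N \frac{s_n}{n} - \tau\right| : s_1, \ldots, s_N \in \{-1,+1\}\right\}$. Let $C$ be a real number with $0 < C < 1/\log 4$, and let $\tau \in \mathbb{R}$. Then $$\#\left\{(s_1, \ldots, s_N) \in \{-1,+1\}^N : \left|\tau - \sum_{n=1}^N \frac{s_n}{n}\right| < \delta\right\} = 2^{N+1} g(\tau)\,\delta\,(1 + o_{C,\tau}(1))$$ as $N \to \infty$ and $\delta \to 0$, uniformly in $\delta \geq \exp\left(-C(\log N)^2\right)$; that is, for every $\varepsilon > 0$ there are $N_0 \in \mathbb{N}$ and $\delta_0 > 0$, depending only on $\varepsilon$, $C$ and $\tau$, such that for all integers $N \geq N_0$ and all real $\delta$ with $\exp\left(-C(\log N)^2\right) \leq \delta < \delta_0$ the left-hand side differs from $2^{N+1} g(\tau)\,\delta$ by at most $\varepsilon\, 2^{N+1}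 g(\tau)\,\delta$. In particular, $\mathfrak{m}_N(\tau) < \exp\left(-C(\log N)^2\right)$ for all sufficiently large $N$ (depending on $C$ and $\tau$). -/

import Mathlib

open Finset

noncomputable section

/-- The signed harmonic sum `∑_{n=1}^N s_n / n` of a sign vector `s ∈ {±1}^N`; the units `ℤˣ` are
exactly `{1, -1}`, and the index `i : Fin N` stands for `n = i + 1`. -/
def signedHarmonicSum {N : ℕ} (s : Fin N → ℤˣ) : ℝ :=
  ∑ i : Fin N, ((s i : ℤ) : ℝ) / ((i : ℝ) + 1)

/-- The finite set of all the values `∑_{n=1}^N s_n / n` with `s_1, …, s_N ∈ {±1}`. -/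
def signedHarmonicSums (N : ℕ) : Finset ℝ :=
  (univ : Finset (Fin N → ℤˣ)).image signedHarmonicSum

theorem signedHarmonicSums_nonempty (N : ℕ) : (signedHarmonicSums N).Nonempty :=
  univ_nonempty.image _

/-- The minimum of the distances `|x - τ|` over the values `x` of the signed harmonic sums. -/
def minDist (N : ℕ) (τ : ℝ) : ℝ :=
  (signedHarmonicSums N).inf' (signedHarmonicSums_nonempty N) (fun x => |x - τ|)

/-- The number of sign vectors `s ∈ {±1}^N` with `|τ - ∑_{n=1}^N s_n / n| < δ`. -/
def signCount (N : ℕ) (τ δ : ℝ) : ℕ :=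
  #{s : Fin N → ℤˣ | |τ - signedHarmonicSum s| < δ}

/-- The density of the random harmonic series,
`g(x) = 2 ∫_0^∞ cos(2πux) ∏_{n=1}^∞ cos(2πu/n) du`. -/
def harmonicDensity (x : ℝ) : ℝ :=
  2 * ∫ u in Set.Ioi (0 : ℝ),
    Real.cos (2 * Real.pi * u * x) * ∏' n : ℕ, Real.cos (2 * Real.pi * u / ((n : ℝ) + 1))

end

open Filter Asymptotics MeasureTheory Topology
open scoped FourierTransform SchwartzMap ContDiff

/-! For uniform random signs the sum has characteristic function `cosProd N u`, the finite product
of `cos (2πu/n)`. Replace the indicator of `|x| < 1` by a smooth bump `f`. Fourier inversion turns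
the smoothed count into `2^N δ` times the integral of the transform of `f` at `δu`, times
`e^{-2πiuτ} cosProd N u`. If the integrand is dominated, this integral tends to `(∫ f) g(τ)`, and
squeezing the indicator between two bumps gives the asymptotic count.

Domination splits at `N/8` and `exp (a log² N)`, with `C < a < 1/log 4`. For small `|u|`, about
`2|u|` of the factors are bounded away from 1 in absolute value, which gives exponential decay. For
large `|u|`, `δ|u|` is so large that the rapid decay of the transform suffices.

The middle range is the heart (`one_le_four_pow_mul_sum_sq_sub_round`, `sqrt_le_sum_sq_sub_round`).
The `k`-th difference of `x/n`, with `x = 2|u|`, is about `x k!/n^(k+1)` in size. Where it lies in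
`[1/4, 1/2]` it is far from every integer, so `k+1` consecutive values `x/n` cannot all be near
integers. Cauchy-Schwarz costs a factor `4^k`. Reaching `exp (a log² N)` takes `k ≤ b log N` with `b
> a`, so the cost is at most `N^(b log 4)`, which stays below `N` because `b < 1/log 4`.

A relative error needs `g(τ) > 0`, shown by counting (`two_pow_le_signCount_mul`): for at least half
of the sign vectors, changing a few signs brings the sum within `δ` of `τ`. -/

/-! ### Distances to the nearest integer along `x/n` -/

/-- Reduce to `t = y - round y`; there `cos (πt) ≤ 1 - 2t² ≤ exp (-2t²)`. -/
theorem abs_cos_pi_mul_le (y : ℝ) :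
    |Real.cos (Real.pi * y)| ≤ Real.exp (-2 * (y - round y) ^ 2) := by
  have h := abs_sub_round y
  set t := y - round y with ht
  have hπ := Real.pi_pos
  have hy : Real.pi * y = Real.pi * t + (round y : ℤ) * Real.pi := by rw [ht]; ring
  have h1 : |Real.cos (Real.pi * y)| = |Real.cos (Real.pi * t)| := by
    rw [hy, Real.cos_add_int_mul_pi, abs_mul, abs_zpow]
    simp
  have h2 : |Real.pi * t| ≤ Real.pi := by
    rw [abs_mul, abs_of_pos hπ]; nlinarith
  have h3 := Real.cos_le_one_sub_mul_cos_sq h2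
  have h4 : 0 ≤ Real.cos (Real.pi * t) := by
    apply Real.cos_nonneg_of_mem_Icc
    rw [abs_le] at h
    constructor <;> nlinarith
  rw [h1, abs_of_nonneg h4]
  have h5 : 2 / Real.pi ^ 2 * (Real.pi * t) ^ 2 = 2 * t ^ 2 := by field_simp
  have h6 := Real.add_one_le_exp (-2 * t ^ 2)
  linarith

theorem fwdDiff_iter_one_div (k n : ℕ) :
    (fwdDiff 1)^[k] (fun n : ℕ => 1 / ((n : ℝ) + 1)) n =
      (-1) ^ k * k.factorial / ∏ j ∈ range (k + 1), ((n : ℝ) + 1 + j) := by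
  induction k generalizing n with
  | zero => simp
  | succ k ih =>
    rw [Function.iterate_succ_apply', fwdDiff, ih, ih]
    have hp : ∀ n : ℕ, (∏ j ∈ range (k + 1), ((n : ℝ) + 1 + j)) ≠ 0 := fun n =>
      (Finset.prod_pos fun j _ => by positivity).ne'
    have e1 : ∏ j ∈ range (k + 1 + 1), ((n : ℝ) + 1 + j) =
        (∏ j ∈ range (k + 1), ((n : ℝ) + 1 + j)) * (n + 1 + (k + 1)) := by
      rw [prod_range_succ]; push_cast; rfl
    have e2 : ∏ j ∈ range (k + 1 + 1), ((n : ℝ) + 1 + j) =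
        (∏ j ∈ range (k + 1), (((n + 1 : ℕ) : ℝ) + 1 + j)) * (n + 1) := by
      rw [prod_range_succ']
      congr 1
      · refine prod_congr rfl fun j _ => ?_
        push_cast; ring
      · simp
    have h0 : (n : ℝ) + 1 ≠ 0 := by positivity
    have h0' : (n : ℝ) + 1 + (k + 1) ≠ 0 := by positivity
    have i1 : (-1 : ℝ) ^ k * k.factorial / ∏ j ∈ range (k + 1), (((n + 1 : ℕ) : ℝ) + 1 + j) =
        (-1 : ℝ) ^ k * k.factorial * (n + 1) / ∏ j ∈ range (k + 1 + 1), ((n : ℝ) + 1 + j) := by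
      rw [e2, mul_div_mul_right _ _ h0]
    have i2 : (-1 : ℝ) ^ k * k.factorial / ∏ j ∈ range (k + 1), ((n : ℝ) + 1 + j) =
        (-1 : ℝ) ^ k * k.factorial * (n + 1 + (k + 1)) /
          ∏ j ∈ range (k + 1 + 1), ((n : ℝ) + 1 + j) := by
      rw [e1, mul_div_mul_right _ _ h0']
    rw [i1, i2, ← sub_div]
    congr 1
    rw [Nat.factorial_succ, pow_succ]
    push_cast
    ring

/-- The `k`-th difference has integer coefficients, so applying it to the deviations from the
nearest integers changes it only by an integer. It remains at least `1/4` in absolute value, and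
Cauchy-Schwarz against `∑ (k choose j)² = (2k choose k) ≤ 4^k` bounds the deviations below. -/
theorem one_le_four_pow_mul_sum_sq_sub_round (x : ℝ) (n k : ℕ)
    (h1 : 1 / 4 ≤ x * k.factorial / ∏ j ∈ range (k + 1), ((n : ℝ) + 1 + j))
    (h2 : x * k.factorial / ∏ j ∈ range (k + 1), ((n : ℝ) + 1 + j) ≤ 1 / 2) :
    1 / 16 ≤ 4 ^ k * ∑ j ∈ range (k + 1),
      (x / ((n : ℝ) + 1 + j) - round (x / ((n : ℝ) + 1 + j))) ^ 2 := by
  set D := x * k.factorial / ∏ j ∈ range (k + 1), ((n : ℝ) + 1 + j) with hD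
  set c : ℕ → ℤ := fun j => (-1) ^ (k - j) * (k.choose j : ℤ) with hc
  have hsum : ∑ j ∈ range (k + 1), (c j : ℝ) * (x / ((n : ℝ) + 1 + j)) = (-1) ^ k * D := by
    have h := fwdDiff_iter_one_div k n
    rw [fwdDiff_iter_eq_sum_shift] at h
    have : (-1) ^ k * D =
        x * ((-1) ^ k * k.factorial / ∏ j ∈ range (k + 1), ((n : ℝ) + 1 + j)) := by
      rw [hD]; ring
    rw [this, ← h, mul_sum]
    refine sum_congr rfl fun j _ => ?_
    simp only [hc, zsmul_eq_mul, smul_eq_mul, mul_one]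
    push_cast
    ring
  have hdec : ∑ j ∈ range (k + 1), (c j : ℝ) *
      (x / ((n : ℝ) + 1 + j) - round (x / ((n : ℝ) + 1 + j))) =
      (-1) ^ k * D - ((∑ j ∈ range (k + 1), c j * round (x / ((n : ℝ) + 1 + j)) : ℤ) : ℝ) := by
    rw [← hsum]
    push_cast
    rw [← sum_sub_distrib]
    exact sum_congr rfl fun j _ => by ring
  have hcs := sum_mul_sq_le_sq_mul_sq (range (k + 1)) (fun j => (c j : ℝ))
    (fun j => x / ((n : ℝ) + 1 + j) - round (x / ((n : ℝ) + 1 + j)))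
  rw [hdec] at hcs
  generalize (∑ j ∈ range (k + 1), c j * round (x / ((n : ℝ) + 1 + j)) : ℤ) = z at hcs
  have hz : 1 / 16 ≤ ((-1) ^ k * D - (z : ℝ)) ^ 2 := by
    have key : ∀ w : ℤ, 1 / 16 ≤ (D - (w : ℝ)) ^ 2 := by
      intro w
      rcases le_or_gt w 0 with hw | hw
      · have : (w : ℝ) ≤ 0 := by exact_mod_cast hw
        nlinarith
      · have : (1 : ℝ) ≤ w := by exact_mod_cast hw
        nlinarith
    rcases neg_one_pow_eq_or ℝ k with h | h
    · rw [h, one_mul]; exact key z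
    · have := key (-z)
      rw [h]; push_cast at this; nlinarith
  have hcc : ∑ j ∈ range (k + 1), (c j : ℝ) ^ 2 ≤ 4 ^ k := by
    have e : ∑ j ∈ range (k + 1), (c j : ℝ) ^ 2 = ((2 * k).choose k : ℝ) := by
      rw [← Nat.sum_range_choose_sq]
      push_cast
      refine sum_congr rfl fun j _ => ?_
      simp only [hc]
      push_cast
      rw [mul_pow, ← pow_mul, mul_comm (k - j), pow_mul]
      simp
    rw [e]
    have : (2 * k).choose k ≤ 4 ^ k := by
      calc _ ≤ 2 ^ (2 * k) := Nat.choose_le_two_pow _ _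
        _ = 4 ^ k := by rw [pow_mul]; norm_num
    exact_mod_cast this
  calc (1 : ℝ) / 16 ≤ _ := hz
    _ ≤ _ := hcs
    _ ≤ _ := by gcongr

theorem sum_range_mul_eq (f : ℕ → ℝ) (a b : ℕ) :
    ∑ m ∈ range (a * b), f m = ∑ i ∈ range a, ∑ j ∈ range b, f (i * b + j) := by
  induction a with
  | zero => simp
  | succ a ih => rw [add_mul, one_mul, sum_range_add, ih, sum_range_succ]

/-- Apply the block estimate to `R` disjoint blocks of length `k+1` starting at `m`. The bound on
`R` keeps all of them in a window where the `k`-th difference varies by at most a factor 2. -/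
theorem le_sum_sq_sub_round {x : ℝ} {k m R N : ℕ}
    (h1 : 2 * x * (k.factorial : ℝ) ≤ ((m : ℝ) + 1) ^ (k + 1))
    (h2 : (m : ℝ) ^ (k + 1) ≤ 2 * x * k.factorial)
    (hR : 2 * (k + 1) ^ 2 * R ≤ m + 1) (hN : m + R * (k + 1) ≤ N) :
    (R : ℝ) / 4 ^ k / 16 ≤ ∑ n ∈ range N, (x / ((n : ℝ) + 1) - round (x / ((n : ℝ) + 1))) ^ 2 := by
  set F : ℕ → ℝ := fun n => (x / ((n : ℝ) + 1) - round (x / ((n : ℝ) + 1))) ^ 2 with hF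
  have hsub : ∑ n ∈ Ico m (m + R * (k + 1)), F n ≤ ∑ n ∈ range N, F n := by
    apply sum_le_sum_of_subset_of_nonneg
    · intro n hn
      simp only [mem_Ico, mem_range] at *
      omega
    · intros; positivity
  refine le_trans ?_ hsub
  rw [sum_Ico_eq_sum_range, add_tsub_cancel_left, sum_range_mul_eq]
  have hblock : ∀ i ∈ range R, 1 / 4 ^ k / 16 ≤ ∑ j ∈ range (k + 1), F (m + (i * (k + 1) + j)) := by
    intro i hi
    rw [mem_range] at hi
    have hx0 : 0 ≤ x * k.factorial := by
      have : (0 : ℝ) ≤ (m : ℝ) ^ (k + 1) := by positivity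
      linarith
    set n := m + i * (k + 1) with hn
    have hlow : ((m : ℝ) + 1) ^ (k + 1) ≤ ∏ j ∈ range (k + 1), ((n : ℝ) + 1 + j) := by
      rw [← card_range (k + 1), ← prod_const, card_range]
      refine prod_le_prod (fun _ _ => by positivity) fun j _ => ?_
      rw [hn]; push_cast
      have : (0 : ℝ) ≤ i * (k + 1) := by positivity
      have : (0 : ℝ) ≤ j := by positivity
      linarith
    have hup : ∏ j ∈ range (k + 1), ((n : ℝ) + 1 + j) ≤ ((m : ℝ) + R * (k + 1)) ^ (k + 1) := by
      conv_rhs => rw [← card_range (k + 1), ← prod_const]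
      refine prod_le_prod (fun _ _ => by positivity) fun j hj => ?_
      have hj' : j + 1 ≤ k + 1 := by simpa using hj
      have : n + 1 + j ≤ m + R * (k + 1) := by
        have : (i + 1) * (k + 1) ≤ R * (k + 1) := Nat.mul_le_mul_right _ hi
        rw [hn]; linarith
      exact_mod_cast this
    have hRpos : (1 : ℝ) ≤ R := by exact_mod_cast (by omega : 1 ≤ R)
    have hRr : 2 * ((k : ℝ) + 1) ^ 2 * R ≤ m + 1 := by exact_mod_cast hR
    have hpos : (0 : ℝ) < (m : ℝ) + R * (k + 1) := by positivity
    -- Bernoulli's inequality for `(m / (m + R(k+1)))^(k+1)`: the bound on `R` makes the linear loss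
    -- at most `1/2`.
    have hbern : ((m : ℝ) + R * (k + 1)) ^ (k + 1) ≤ 2 * (m : ℝ) ^ (k + 1) := by
      have hk0 : (0 : ℝ) ≤ k := by positivity
      have hq : (R * (k + 1) : ℝ) / ((m : ℝ) + R * (k + 1)) ≤ 1 := by
        rw [div_le_one hpos]; have : (0 : ℝ) ≤ m := by positivity
        linarith
      have hb := one_add_mul_le_pow (a := -((R * (k + 1) : ℝ) / ((m : ℝ) + R * (k + 1))))
        (by linarith) (k + 1)
      have e : 1 + -((R * (k + 1) : ℝ) / ((m : ℝ) + R * (k + 1))) =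
          m / ((m : ℝ) + R * (k + 1)) := by rw [← sub_eq_add_neg, one_sub_div hpos.ne', add_sub_cancel_right]
      rw [e, div_pow] at hb
      have hh : ((k + 1 : ℕ) : ℝ) * ((R * (k + 1) : ℝ) / ((m : ℝ) + R * (k + 1))) ≤ 1 / 2 := by
        rw [← mul_div_assoc, div_le_iff₀ hpos]
        push_cast
        nlinarith
      have : 1 / 2 ≤ (m : ℝ) ^ (k + 1) / ((m : ℝ) + R * (k + 1)) ^ (k + 1) := by linarith
      rw [le_div_iff₀ (by positivity)] at this
      linarith
    have hprodpos : (0 : ℝ) < ∏ j ∈ range (k + 1), ((n : ℝ) + 1 + j) :=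
      prod_pos fun j _ => by positivity
    have key := one_le_four_pow_mul_sum_sq_sub_round x n k
      (by rw [le_div_iff₀ hprodpos]; linarith) (by rw [div_le_iff₀ hprodpos]; linarith)
    have e : ∑ j ∈ range (k + 1), (x / ((n : ℝ) + 1 + j) - round (x / ((n : ℝ) + 1 + j))) ^ 2 =
        ∑ j ∈ range (k + 1), F (m + (i * (k + 1) + j)) := by
      refine sum_congr rfl fun j _ => ?_
      have : (n : ℝ) + 1 + j = ((m + (i * (k + 1) + j) : ℕ) : ℝ) + 1 := by
        rw [hn]; push_cast; ring
      rw [this]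
    rw [e] at key
    have h4 : (0 : ℝ) < 4 ^ k := by positivity
    rw [div_div, div_le_iff₀ (by positivity)]
    linarith
  calc (R : ℝ) / 4 ^ k / 16 = ∑ i ∈ range R, 1 / 4 ^ k / 16 := by
        rw [sum_const, card_range, nsmul_eq_mul]; ring
    _ ≤ _ := sum_le_sum hblock

/-! ### Decay of the characteristic function -/

/-- The characteristic function `∏_{n ≤ N} cos (2πu/n)` of the random harmonic sum. -/
noncomputable def cosProd (N : ℕ) (u : ℝ) : ℝ :=
  ∏ n ∈ range N, Real.cos (2 * Real.pi * u / ((n : ℝ) + 1))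

theorem abs_cosProd_le (N : ℕ) (u : ℝ) :
    |cosProd N u| ≤ Real.exp (-2 * ∑ n ∈ range N,
      (2 * u / ((n : ℝ) + 1) - round (2 * u / ((n : ℝ) + 1))) ^ 2) := by
  rw [cosProd, abs_prod, mul_sum, Real.exp_sum]
  refine prod_le_prod (fun _ _ => abs_nonneg _) fun n _ => ?_
  have := abs_cos_pi_mul_le (2 * u / ((n : ℝ) + 1))
  rwa [show Real.pi * (2 * u / ((n : ℝ) + 1)) = 2 * Real.pi * u / ((n : ℝ) + 1) by ring] at this

theorem cosProd_abs (N : ℕ) (u : ℝ) : cosProd N |u| = cosProd N u := by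
  rcases abs_choice u with h | h <;> rw [h]
  simp [cosProd, neg_div]

/-- The case `k = 0`: from `m = ⌊4|u|⌋` on, about `2|u|` of the values `2|u|/(n+1)` themselves lie
in `[1/4, 1/2]`. -/
theorem abs_cosProd_le_exp {N : ℕ} {u : ℝ} (h : 8 * |u| ≤ N) :
    |cosProd N u| ≤ Real.exp (1 - |u| / 4) := by
  rw [← cosProd_abs]
  have hu : 0 ≤ |u| := abs_nonneg u
  generalize |u| = v at *
  refine (abs_cosProd_le N v).trans (Real.exp_le_exp.2 ?_)
  have hm1 := Nat.floor_le (by linarith : 0 ≤ 4 * v)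
  have hm2 := Nat.lt_floor_add_one (4 * v)
  set m := ⌊4 * v⌋₊
  have hmN : 2 * m ≤ N := by
    have : (2 * m : ℝ) ≤ N := by linarith
    exact_mod_cast this
  have key := le_sum_sq_sub_round (x := 2 * v) (k := 0) (m := m) (R := (m + 1) / 2) (N := N)
    (by simp; linarith) (by simp; linarith) (by omega) (by omega)
  have hR : (m : ℝ) ≤ 2 * ((m + 1) / 2 : ℕ) := by
    have : m ≤ 2 * ((m + 1) / 2) := by omega
    exact_mod_cast this
  simp only [pow_zero, div_one] at key
  linarith

/-- Take the least order `k` for which the window lies below `H`. Minimality gives `H^k ≤ 2x k! ≤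
(m+1)^(k+1)`, so the window starts at least at `H^(k/(k+1))`, up to 1. As `k ≥ 1`, this exponent is
at least `1/2`, whence the square root. -/
theorem sqrt_le_sum_sq_sub_round {x : ℝ} {N H K : ℕ} (hHN : 2 * H ≤ N)
    (hx : H < 2 * x) (hK : 2 * x * K.factorial ≤ (H : ℝ) ^ (K + 1)) (hH : 4 ^ (K + 1) ≤ H) :
    √((H : ℝ) / 4 ^ (K + 1)) / (32 * ((K : ℝ) + 1) ^ 2) - 1 / 16 ≤
      ∑ n ∈ range N, (x / ((n : ℝ) + 1) - round (x / ((n : ℝ) + 1))) ^ 2 := by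
  classical
  have hHpos : 0 < H := lt_of_lt_of_le (by positivity) hH
  have hexk : ∃ k : ℕ, 2 * x * k.factorial ≤ (H : ℝ) ^ (k + 1) := ⟨K, hK⟩
  set k := Nat.find hexk with hk
  have hkK : k ≤ K := Nat.find_min' hexk hK
  have hkspec : 2 * x * k.factorial ≤ (H : ℝ) ^ (k + 1) := Nat.find_spec hexk
  -- Order 0 would need `2x ≤ H`, which `hx` excludes.
  have hk0 : k ≠ 0 := by
    intro h0
    rw [h0] at hkspec
    simp at hkspec
    linarith
  obtain ⟨l, hl⟩ := Nat.exists_eq_succ_of_ne_zero hk0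
  have hlmin : (H : ℝ) ^ (l + 1) < 2 * x * l.factorial := by
    have := Nat.find_min hexk (m := l) (by omega)
    simpa using this
  have hHk : (H : ℝ) ^ k ≤ 2 * x * k.factorial := by
    have : (l.factorial : ℝ) ≤ k.factorial := by
      exact_mod_cast Nat.factorial_le (by omega)
    have hx0 : 0 ≤ 2 * x := by
      have : (0 : ℝ) ≤ H := by positivity
      linarith
    rw [hl] at this ⊢
    exact hlmin.le.trans (by gcongr)
  -- The least such `m` is where the `k`-th difference first drops to `1/2`.
  have hexm : ∃ m : ℕ, 2 * x * k.factorial ≤ ((m : ℝ) + 1) ^ (k + 1) :=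
    ⟨H - 1, by rw [Nat.cast_sub hHpos]; simpa using hkspec⟩
  set m := Nat.find hexm with hm
  have hmspec : 2 * x * k.factorial ≤ ((m : ℝ) + 1) ^ (k + 1) := Nat.find_spec hexm
  have hmH : m ≤ H - 1 :=
    Nat.find_min' hexm (by rw [Nat.cast_sub hHpos]; simpa using hkspec)
  have hm2 : (m : ℝ) ^ (k + 1) ≤ 2 * x * k.factorial := by
    rcases Nat.eq_zero_or_pos m with h0 | h0
    · rw [h0]; simp
      have : (0 : ℝ) ≤ H ^ k := by positivity
      linarith
    · have := Nat.find_min hexm (m := m - 1) (by omega)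
      rw [Nat.cast_sub h0] at this
      simp at this
      exact this.le
  set R := (m + 1) / (2 * (k + 1) ^ 2) with hR
  have hR1 : 2 * (k + 1) ^ 2 * R ≤ m + 1 := Nat.mul_div_le _ _
  have hR2 : m + R * (k + 1) ≤ N := by
    have : R * (k + 1) ≤ 2 * (k + 1) ^ 2 * R := by nlinarith [Nat.zero_le (R * k)]
    omega
  have key := le_sum_sq_sub_round hmspec hm2 hR1 hR2
  refine le_trans ?_ key
  have hR3 : ((m : ℝ) + 1) / (2 * ((k : ℝ) + 1) ^ 2) - 1 ≤ R := by
    have : m + 1 ≤ 2 * (k + 1) ^ 2 * (R + 1) := by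
      have := Nat.lt_mul_div_succ (m + 1) (by positivity : 0 < 2 * (k + 1) ^ 2)
      exact this.le
    have h' : (m : ℝ) + 1 ≤ 2 * ((k : ℝ) + 1) ^ 2 * (R + 1) := by exact_mod_cast this
    rw [sub_le_iff_le_add, div_le_iff₀ (by positivity)]
    linarith
  set z : ℝ := ((m : ℝ) + 1) / 4 ^ k with hz
  have hz0 : 0 < z := by positivity
  have h4K : (4 : ℝ) ^ (k + 1) ≤ 4 ^ (K + 1) := pow_le_pow_right₀ (by norm_num) (by omega)
  have hHr : (4 : ℝ) ^ (K + 1) ≤ H := by exact_mod_cast hH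
  have hzy : (H : ℝ) / 4 ^ (k + 1) ≤ z ^ 2 := by
    set y : ℝ := (H : ℝ) / 4 ^ (k + 1) with hy
    have hy1 : 1 ≤ y := by rw [hy, one_le_div (by positivity)]; linarith
    have hzk : y ^ k ≤ z ^ (k + 1) := by
      rw [hy, hz, div_pow, div_pow, ← pow_mul, ← pow_mul, mul_comm (k + 1) k]
      gcongr
      linarith
    refine le_of_pow_le_pow_left₀ (n := k + 1) (by omega) (by positivity) ?_
    -- Here `k ≥ 1` enters, as `k + 1 ≤ 2k`.
    calc y ^ (k + 1) ≤ y ^ (k * 2) := pow_le_pow_right₀ hy1 (by omega)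
      _ = (y ^ k) ^ 2 := pow_mul _ _ _
      _ ≤ (z ^ (k + 1)) ^ 2 := by gcongr
      _ = (z ^ 2) ^ (k + 1) := by rw [← pow_mul, ← pow_mul, mul_comm]
  have hsz : √((H : ℝ) / 4 ^ (K + 1)) ≤ z := by
    rw [Real.sqrt_le_left hz0.le]
    refine le_trans ?_ hzy
    gcongr
  have hkr : (k : ℝ) ≤ K := by exact_mod_cast hkK
  calc √((H : ℝ) / 4 ^ (K + 1)) / (32 * ((K : ℝ) + 1) ^ 2) - 1 / 16
      ≤ z / (32 * ((k : ℝ) + 1) ^ 2) - 1 / 16 := by gcongr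
    _ ≤ z / (32 * ((k : ℝ) + 1) ^ 2) - 1 / 4 ^ k / 16 := by
        have : (1 : ℝ) / 4 ^ k ≤ 1 := by
          rw [div_le_one (by positivity)]; exact one_le_pow₀ (by norm_num)
        linarith
    _ = (((m : ℝ) + 1) / (2 * ((k : ℝ) + 1) ^ 2) - 1) / 4 ^ k / 16 := by
        rw [hz]; field_simp; ring
    _ ≤ _ := by gcongr

/-- With `L = log N` and `K = ⌊bL⌋` this is the logarithm of `4 e^(aL²) (bL+1)^(bL) ≤ (N/3)^(bL)`,
used to make order `K` admissible. The factorial contributes only `O(L log L)`, absorbed by the gap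
`(b - a) L²`. -/
theorem eventually_quadratic_entropy_le {a b : ℝ} (ha : 0 < a) (hab : a < b) :
    ∀ᶠ L : ℝ in atTop,
      Real.log 4 + a * L ^ 2 + b * L * Real.log (b * L + 1) ≤ b * L * (L - Real.log 3) := by
  have hb : 0 < b := ha.trans hab
  have hη : 0 < (b - a) / (2 * b) / (b + 1) := by
    have : 0 < b - a := by linarith
    positivity
  have htend : Tendsto (fun L : ℝ => b * L + 1) atTop atTop :=
    tendsto_atTop_add_const_right _ _ (tendsto_id.const_mul_atTop hb)
  have hlog := (Real.isLittleO_log_id_atTop.comp_tendsto htend).bound hη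
  filter_upwards [hlog, eventually_ge_atTop (1 : ℝ),
    eventually_ge_atTop ((Real.log 4 + b * Real.log 3) / ((b - a) / 2))] with L h1 h2 h3
  have hba : 0 < (b - a) / 2 := by linarith
  rw [div_le_iff₀ hba] at h3
  simp only [Function.comp_apply, id, Real.norm_eq_abs] at h1
  rw [abs_of_pos (by positivity : 0 < b * L + 1)] at h1
  have h4 : Real.log (b * L + 1) ≤ (b - a) / (2 * b) * L := by
    calc Real.log (b * L + 1) ≤ _ := (le_abs_self _).trans h1
      _ ≤ (b - a) / (2 * b) / (b + 1) * ((b + 1) * L) := by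
        gcongr
        linarith
      _ = _ := by field_simp
  have h5 : b * L * Real.log (b * L + 1) ≤ (b - a) / 2 * L ^ 2 := by
    calc _ ≤ b * L * ((b - a) / (2 * b) * L) := by gcongr
      _ = _ := by field_simp
  have hl4 : 0 ≤ Real.log 4 := Real.log_nonneg (by norm_num)
  have hl3 : 0 ≤ Real.log 3 := Real.log_nonneg (by norm_num)
  nlinarith

theorem eventually_const_mul_pow_le_exp {θ : ℝ} (hθ : 0 < θ) (c : ℝ) (n : ℕ) :
    ∀ᶠ L : ℝ in atTop, c * L ^ n ≤ Real.exp (θ * L) := by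
  have h := (isLittleO_pow_exp_pos_mul_atTop n hθ).bound
    (by positivity : 0 < (|c| + 1)⁻¹)
  filter_upwards [h, eventually_ge_atTop 0] with L h h0
  rw [Real.norm_of_nonneg (by positivity), Real.norm_of_nonneg (by positivity)] at h
  have hc : 0 < |c| + 1 := by positivity
  rw [← div_eq_inv_mul, le_div_iff₀ hc] at h
  have : c * L ^ n ≤ (|c| + 1) * L ^ n := by
    gcongr
    linarith [le_abs_self c]
  linarith

/-- The cube of `log N` is chosen so that `exp (-2 log³ N)` beats the length `exp (a log² N)` of the
middle range. -/
theorem eventually_log_pow_three_le_sum {a : ℝ} (ha : 0 < a) (ha' : a < 1 / Real.log 4) :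
    ∀ᶠ N : ℕ in atTop, ∀ x : ℝ, (N : ℝ) < 4 * x → x ≤ 2 * Real.exp (a * Real.log N ^ 2) →
      Real.log N ^ 3 ≤
        ∑ n ∈ range N, (x / ((n : ℝ) + 1) - round (x / ((n : ℝ) + 1))) ^ 2 := by
  have hl4 : 0 < Real.log 4 := Real.log_pos (by norm_num)
  obtain ⟨b, hab, hb'⟩ := exists_between ha'
  have hb : 0 < b := ha.trans hab
  have hθ : 0 < 1 - b * Real.log 4 := by
    rw [lt_div_iff₀ hl4] at hb'; linarith
  have hlogN : Tendsto (fun N : ℕ => Real.log N) atTop atTop :=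
    Real.tendsto_log_atTop.comp tendsto_natCast_atTop_atTop
  filter_upwards [hlogN.eventually (eventually_quadratic_entropy_le ha hab),
    hlogN.eventually (eventually_const_mul_pow_le_exp hθ (12 * (64 * (b + 1) ^ 2) ^ 2) 10),
    hlogN.eventually (eventually_ge_atTop 1),
    eventually_ge_atTop 6] with N h1 h2 h3 h6 x hx1 hx2
  set L := Real.log N with hL
  have hNpos : (0 : ℝ) < N := by exact_mod_cast (by omega : 0 < N)
  set K := ⌊b * L⌋₊ with hK
  have hbL : 0 ≤ b * L := by positivity
  have hK1 : (K : ℝ) ≤ b * L := Nat.floor_le hbL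
  have hK2 : b * L < K + 1 := Nat.lt_floor_add_one _
  set H := N / 2 with hH
  have hHN : 2 * H ≤ N := Nat.mul_div_le _ _
  have hH3 : (N : ℝ) / 3 ≤ H := by
    have : N ≤ 3 * H := by omega
    have : (N : ℝ) ≤ 3 * H := by exact_mod_cast this
    linarith
  have hHexp : Real.exp (L - Real.log 3) ≤ H := by
    rw [Real.exp_sub, hL, Real.exp_log hNpos, Real.exp_log (by norm_num)]
    exact hH3
  have hxH : (H : ℝ) < 2 * x := by
    have : (2 * H : ℝ) ≤ N := by exact_mod_cast hHN
    linarith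
  have hl3L : Real.log 3 ≤ L := Real.log_le_log (by norm_num) (by
    exact_mod_cast (by omega : 3 ≤ N))
  have hfact : 2 * x * (K.factorial : ℝ) ≤ (H : ℝ) ^ (K + 1) := by
    have e1 : (K.factorial : ℝ) ≤ Real.exp (b * L * Real.log (b * L + 1)) := by
      calc (K.factorial : ℝ) ≤ (K : ℝ) ^ K := by exact_mod_cast Nat.factorial_le_pow K
        _ ≤ (b * L + 1) ^ K := by gcongr; linarith
        _ = Real.exp (K * Real.log (b * L + 1)) := by
          rw [Real.exp_nat_mul, Real.exp_log (by positivity)]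
        _ ≤ _ := by
          have : 0 ≤ Real.log (b * L + 1) := Real.log_nonneg (by linarith)
          gcongr
    have e2 : Real.exp (b * L * (L - Real.log 3)) ≤ (H : ℝ) ^ (K + 1) := by
      calc Real.exp (b * L * (L - Real.log 3)) ≤ Real.exp ((K + 1 : ℕ) * (L - Real.log 3)) := by
            push_cast
            gcongr
        _ = Real.exp (L - Real.log 3) ^ (K + 1) := Real.exp_nat_mul _ _
        _ ≤ _ := by gcongr
    calc 2 * x * (K.factorial : ℝ)
        ≤ 2 * (2 * Real.exp (a * L ^ 2)) * Real.exp (b * L * Real.log (b * L + 1)) := by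
          gcongr
      _ = Real.exp (Real.log 4 + a * L ^ 2 + b * L * Real.log (b * L + 1)) := by
          rw [Real.exp_add, Real.exp_add, Real.exp_log (by norm_num)]; ring
      _ ≤ Real.exp (b * L * (L - Real.log 3)) := Real.exp_le_exp.2 h1
      _ ≤ _ := e2
  -- The right side is at least `N^(1 - b log 4) / 12`, a positive power of `N`. In `L^5`, three
  -- powers are the target and two pay for `(K+1)²`.
  have hy : (64 * (b + 1) ^ 2 * L ^ 5) ^ 2 ≤ (H : ℝ) / 4 ^ (K + 1) := by
    have e4 : (4 : ℝ) ^ (K + 1) ≤ Real.exp ((b * L + 1) * Real.log 4) := by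
      calc (4 : ℝ) ^ (K + 1) = Real.exp ((K + 1 : ℕ) * Real.log 4) := by
            rw [Real.exp_nat_mul, Real.exp_log (by norm_num)]
        _ ≤ _ := by push_cast; gcongr
    have e5 : Real.exp ((1 - b * Real.log 4) * L) / 12 ≤ (H : ℝ) / 4 ^ (K + 1) := by
      calc Real.exp ((1 - b * Real.log 4) * L) / 12 =
          Real.exp (L - Real.log 3) / Real.exp ((b * L + 1) * Real.log 4) := by
            rw [← Real.exp_sub]
            have : L - Real.log 3 - (b * L + 1) * Real.log 4 =
              (1 - b * Real.log 4) * L - Real.log 12 := by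
              rw [show (12 : ℝ) = 3 * 4 by norm_num, Real.log_mul (by norm_num) (by norm_num)]
              ring
            rw [this, Real.exp_sub, Real.exp_log (by norm_num : (0 : ℝ) < 12)]
        _ ≤ _ := by gcongr
    refine le_trans ?_ e5
    rw [le_div_iff₀ (by norm_num)]
    calc (64 * (b + 1) ^ 2 * L ^ 5) ^ 2 * 12 = 12 * (64 * (b + 1) ^ 2) ^ 2 * L ^ 10 := by ring
      _ ≤ _ := h2
  have hbig : 1 ≤ 64 * (b + 1) ^ 2 * L ^ 5 := by
    have : 1 ≤ L ^ 5 := one_le_pow₀ h3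
    have : 1 ≤ (b + 1) ^ 2 := one_le_pow₀ (by linarith)
    nlinarith
  have h4H : 4 ^ (K + 1) ≤ H := by
    have : (1 : ℝ) ≤ (H : ℝ) / 4 ^ (K + 1) := (one_le_pow₀ hbig).trans hy
    rw [one_le_div (by positivity)] at this
    exact_mod_cast this
  refine le_trans ?_ (sqrt_le_sum_sq_sub_round hHN hxH hfact h4H)
  have hsq : 64 * (b + 1) ^ 2 * L ^ 5 ≤ √((H : ℝ) / 4 ^ (K + 1)) := Real.le_sqrt_of_sq_le hy
  have hKL : ((K : ℝ) + 1) ^ 2 ≤ ((b + 1) * L) ^ 2 := by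
    gcongr
    nlinarith
  have : L ^ 3 * 2 ≤ √((H : ℝ) / 4 ^ (K + 1)) / (32 * ((K : ℝ) + 1) ^ 2) := by
    rw [le_div_iff₀ (by positivity)]
    calc L ^ 3 * 2 * (32 * ((K : ℝ) + 1) ^ 2) ≤ L ^ 3 * 2 * (32 * ((b + 1) * L) ^ 2) := by gcongr
      _ = 64 * (b + 1) ^ 2 * L ^ 5 := by ring
      _ ≤ _ := hsq
  have : 1 ≤ L ^ 3 := one_le_pow₀ h3
  linarith

theorem eventually_abs_cosProd_le_of_log_sq {a : ℝ} (ha : 0 < a) (ha' : a < 1 / Real.log 4) :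
    ∀ᶠ N : ℕ in atTop, ∀ u : ℝ, (N : ℝ) < 8 * |u| → |u| ≤ Real.exp (a * Real.log N ^ 2) →
      |cosProd N u| ≤ Real.exp (-2 * Real.log N ^ 3) := by
  filter_upwards [eventually_log_pow_three_le_sum ha ha'] with N h u h1 h2
  rw [← cosProd_abs]
  refine (abs_cosProd_le N |u|).trans (Real.exp_le_exp.2 ?_)
  have := h (2 * |u|) (by linarith) (by linarith)
  linarith

theorem abs_cosProd_le_one (N : ℕ) (u : ℝ) : |cosProd N u| ≤ 1 := by
  rw [cosProd, abs_prod]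
  exact prod_le_one (fun _ _ => abs_nonneg _) fun _ _ => Real.abs_cos_le_one _

theorem continuous_cosProd (N : ℕ) : Continuous (cosProd N) := by
  unfold cosProd; fun_prop

theorem tendsto_cosProd (u : ℝ) :
    Tendsto (fun N => cosProd N u) atTop
      (𝓝 (∏' n : ℕ, Real.cos (2 * Real.pi * u / ((n : ℝ) + 1)))) := by
  have hs : Summable fun n : ℕ => Real.cos (2 * Real.pi * u / ((n : ℝ) + 1)) - 1 := by
    have h2 : Summable fun n : ℕ => (2 * Real.pi * u) ^ 2 / 2 * (1 / ((n + 1 : ℕ) : ℝ) ^ 2) :=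
      ((summable_nat_add_iff 1).2 (Real.summable_one_div_nat_pow.2 one_lt_two)).mul_left _
    refine Summable.of_norm_bounded h2 fun n => ?_
    rw [Real.norm_eq_abs, abs_le]
    have h3 := Real.one_sub_sq_div_two_le_cos (x := 2 * Real.pi * u / ((n : ℝ) + 1))
    have h4 := Real.cos_le_one (2 * Real.pi * u / ((n : ℝ) + 1))
    have h5 : (2 * Real.pi * u) ^ 2 / 2 * (1 / ((n + 1 : ℕ) : ℝ) ^ 2) =
        (2 * Real.pi * u / ((n : ℝ) + 1)) ^ 2 / 2 := by
      push_cast; rw [div_pow]; ring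
    rw [h5]
    have : 0 ≤ (2 * Real.pi * u / ((n : ℝ) + 1)) ^ 2 / 2 := by positivity
    constructor <;> linarith
  have hm := (Real.multipliable_one_add_of_summable hs).tendsto_prod_tprod_nat
  simpa [cosProd] using hm

/-! ### Fourier inversion for smoothed counts -/

theorem sum_exp_mul_signedHarmonicSum (N : ℕ) (u : ℝ) :
    ∑ s : Fin N → ℤˣ, Complex.exp ((2 * Real.pi * u * signedHarmonicSum s : ℝ) * Complex.I) =
      2 ^ N * (cosProd N u : ℂ) := by
  have h1 : ∀ s : Fin N → ℤˣ,
      Complex.exp ((2 * Real.pi * u * signedHarmonicSum s : ℝ) * Complex.I) =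
      ∏ i : Fin N, Complex.exp (((s i : ℤ) : ℂ) *
        ((2 * Real.pi * u / ((i : ℝ) + 1) : ℝ) : ℂ) * Complex.I) := by
    intro s
    rw [← Complex.exp_sum, signedHarmonicSum, mul_sum]
    push_cast
    rw [sum_mul]
    congr 1
    exact sum_congr rfl fun i _ => by ring
  simp_rw [h1]
  rw [← Fintype.prod_sum (fun (i : Fin N) (σ : ℤˣ) => Complex.exp (((σ : ℤ) : ℂ) *
        ((2 * Real.pi * u / ((i : ℝ) + 1) : ℝ) : ℂ) * Complex.I)), cosProd, ← Fin.prod_univ_eq_prod_range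
    (fun n => Real.cos (2 * Real.pi * u / ((n : ℝ) + 1)))]
  have h2 : ∀ i : Fin N, ∑ σ : ℤˣ, Complex.exp (((σ : ℤ) : ℂ) *
        ((2 * Real.pi * u / ((i : ℝ) + 1) : ℝ) : ℂ) * Complex.I) =
      2 * ((Real.cos (2 * Real.pi * u / ((i : ℝ) + 1)) : ℝ) : ℂ) := by
    intro i
    rw [UnitsInt.univ, sum_pair (by decide), Complex.ofReal_cos, Complex.two_cos]
    simp
  simp_rw [h2]
  rw [prod_mul_distrib, prod_const, card_univ, Fintype.card_fin]
  push_cast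
  rfl

/-- The integrand of the Fourier inversion formula for smoothed counts of signed sums. -/
noncomputable def fourierIntegrand (F : 𝓢(ℝ, ℂ)) (τ : ℝ) (N : ℕ) (δ u : ℝ) : ℂ :=
  𝓕 F (δ * u) * Complex.exp ((-(2 * Real.pi * u * τ) : ℝ) * Complex.I) * cosProd N u

theorem continuous_fourierIntegrand (F : 𝓢(ℝ, ℂ)) (τ : ℝ) (N : ℕ) (δ : ℝ) :
    Continuous (fourierIntegrand F τ N δ) := by
  have h1 := (𝓕 F).continuous
  have h2 := continuous_cosProd N
  unfold fourierIntegrand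
  fun_prop

theorem norm_fourierIntegrand (F : 𝓢(ℝ, ℂ)) (τ : ℝ) (N : ℕ) (δ u : ℝ) :
    ‖fourierIntegrand F τ N δ u‖ = ‖𝓕 F (δ * u)‖ * |cosProd N u| := by
  rw [fourierIntegrand, norm_mul, norm_mul, Complex.norm_exp_ofReal_mul_I, mul_one,
    Complex.norm_real, Real.norm_eq_abs]

theorem integrable_fourierIntegrand (F : 𝓢(ℝ, ℂ)) (τ : ℝ) (N : ℕ) {δ : ℝ} (hδ : δ ≠ 0) :
    Integrable (fourierIntegrand F τ N δ) := by
  refine (((𝓕 F).integrable (μ := volume)).comp_mul_left' hδ).mono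
    (continuous_fourierIntegrand F τ N δ).aestronglyMeasurable (Eventually.of_forall fun u => ?_)
  rw [norm_fourierIntegrand]
  exact mul_le_of_le_one_right (norm_nonneg _) (abs_cosProd_le_one N u)

theorem sum_schwartz_eq_integral (F : 𝓢(ℝ, ℂ)) (τ : ℝ) (N : ℕ) {δ : ℝ} (hδ : 0 < δ) :
    ∑ s : Fin N → ℤˣ, F ((signedHarmonicSum s - τ) / δ) =
      2 ^ N * δ * ∫ u, fourierIntegrand F τ N δ u := by
  have hint : ∀ y : ℝ, Integrable fun u : ℝ =>
      Complex.exp ((2 * Real.pi * u * y : ℝ) * Complex.I) * 𝓕 F (δ * u) := by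
    intro y
    have h1 := (𝓕 F).continuous
    refine (((𝓕 F).integrable (μ := volume)).comp_mul_left' hδ.ne').mono
      (Continuous.aestronglyMeasurable (by fun_prop)) (Eventually.of_forall fun u => ?_)
    rw [norm_mul, Complex.norm_exp_ofReal_mul_I, one_mul]
  have hF : ∀ y : ℝ, F (y / δ) =
      δ * ∫ u : ℝ, Complex.exp ((2 * Real.pi * u * y : ℝ) * Complex.I) * 𝓕 F (δ * u) := by
    intro y
    have h1 : F (y / δ) = 𝓕⁻ (𝓕 F) (y / δ) := by simp
    rw [h1, SchwartzMap.fourierInv_coe, Real.fourierInv_eq']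
    have h2 := Measure.integral_comp_mul_left (fun v : ℝ =>
      Complex.exp ((2 * Real.pi * inner ℝ v (y / δ) : ℝ) * Complex.I) • 𝓕 F v) δ
    rw [abs_of_pos (inv_pos.2 hδ)] at h2
    have h3 : ∀ u : ℝ, Complex.exp ((2 * Real.pi * inner ℝ (δ * u) (y / δ) : ℝ) * Complex.I) •
        𝓕 F (δ * u) = Complex.exp ((2 * Real.pi * u * y : ℝ) * Complex.I) * 𝓕 F (δ * u) := by
      intro u
      have : 2 * Real.pi * inner ℝ (δ * u) (y / δ) = 2 * Real.pi * u * y := by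
        simp only [RCLike.inner_apply, conj_trivial]
        field_simp
      rw [this, smul_eq_mul]
    simp_rw [h3] at h2
    rw [h2, Complex.real_smul, ← mul_assoc, ← Complex.ofReal_mul, mul_inv_cancel₀ hδ.ne',
      Complex.ofReal_one, one_mul]
  simp_rw [hF]
  rw [← mul_sum, ← integral_finsetSum _ fun s _ => hint _, mul_comm (2 ^ N : ℂ), mul_assoc,
    ← integral_const_mul ((2 : ℂ) ^ N)]
  congr 2
  ext u
  have h4 : ∀ s : Fin N → ℤˣ,
      Complex.exp ((2 * Real.pi * u * (signedHarmonicSum s - τ) : ℝ) * Complex.I) * 𝓕 F (δ * u) =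
      Complex.exp ((2 * Real.pi * u * signedHarmonicSum s : ℝ) * Complex.I) *
        (Complex.exp ((-(2 * Real.pi * u * τ) : ℝ) * Complex.I) * 𝓕 F (δ * u)) := by
    intro s
    rw [← mul_assoc, ← Complex.exp_add, ← add_mul, ← Complex.ofReal_add]
    congr 4
    ring
  simp_rw [h4]
  rw [← sum_mul, sum_exp_mul_signedHarmonicSum, fourierIntegrand]
  ring

/-! ### Dominated convergence in the range `δ ≥ exp (-C (log N)²)` -/

/-- The filter `N → ∞`, `δ → 0⁺` restricted to `δ ≥ exp (-C (log N)²)`. -/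
def logSqFilter (C : ℝ) : Filter (ℕ × ℝ) :=
  (atTop ×ˢ 𝓝[>] (0 : ℝ)) ⊓ 𝓟 {p | Real.exp (-C * Real.log p.1 ^ 2) ≤ p.2}

instance (C : ℝ) : (logSqFilter C).IsCountablyGenerated := by
  unfold logSqFilter; infer_instance

theorem tendsto_fst_logSqFilter (C : ℝ) : Tendsto Prod.fst (logSqFilter C) atTop :=
  tendsto_fst.mono_left inf_le_left

theorem tendsto_snd_logSqFilter (C : ℝ) : Tendsto Prod.snd (logSqFilter C) (𝓝[>] 0) :=
  tendsto_snd.mono_left inf_le_left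

theorem eventually_logSqFilter (C : ℝ) :
    ∀ᶠ p in logSqFilter C, Real.exp (-C * Real.log p.1 ^ 2) ≤ p.2 :=
  mem_inf_of_right (mem_principal_self _)

theorem exp_one_sub_div_four_le {t : ℝ} (ht : 0 ≤ t) :
    Real.exp (1 - t / 4) ≤ 96 * (1 + t ^ 2)⁻¹ := by
  have h1 := Real.quadratic_le_exp_of_nonneg (by positivity : 0 ≤ t / 4)
  have h2 := Real.exp_one_lt_three
  rw [Real.exp_sub, ← div_eq_mul_inv, div_le_div_iff₀ (Real.exp_pos _) (by positivity)]
  nlinarith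

/-- The integrable majorant is independent of `N` and `δ`. Its three ranges use, in turn,
exponential decay of `cosProd`, the bound `exp (-2 log³ N)`, and the Schwartz decay of the
transform. -/
theorem eventually_norm_fourierIntegrand_le {C : ℝ} (hC0 : 0 < C) (hC : C < 1 / Real.log 4)
    (F : 𝓢(ℝ, ℂ)) (τ : ℝ) :
    ∃ B : ℝ, ∀ᶠ p in logSqFilter C, ∀ u : ℝ,
      ‖fourierIntegrand F τ p.1 p.2 u‖ ≤ B * (1 + u ^ 2)⁻¹ := by
  obtain ⟨a, hCa, ha⟩ := exists_between hC
  have ha0 : 0 < a := hC0.trans hCa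
  -- Chosen so that `δ^(j+2) |u|^j ≥ exp (L²)` once `|u| > exp (a L²)`; the two further powers of
  -- `|u|` in the decay of order `j + 2` supply the factor `u²`.
  obtain ⟨j, hj⟩ := exists_nat_ge ((1 + 2 * C) / (a - C))
  rw [div_le_iff₀ (by linarith)] at hj
  obtain ⟨B, hB0, hB⟩ := (𝓕 F).decay 0 0
  obtain ⟨D, hD0, hD⟩ := (𝓕 F).decay (j + 2) 0
  simp only [pow_zero, one_mul, norm_iteratedFDeriv_zero] at hB hD
  refine ⟨96 * B + 1, ?_⟩
  have hlog : Tendsto (fun p : ℕ × ℝ => Real.log p.1) (logSqFilter C) atTop :=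
    Real.tendsto_log_atTop.comp (tendsto_natCast_atTop_atTop.comp (tendsto_fst_logSqFilter C))
  have hpos : ∀ᶠ p in logSqFilter C, 0 < p.2 :=
    (tendsto_snd_logSqFilter C).eventually self_mem_nhdsWithin
  filter_upwards [hpos, eventually_logSqFilter C,
    (tendsto_fst_logSqFilter C).eventually (eventually_abs_cosProd_le_of_log_sq ha0 ha),
    hlog.eventually (eventually_ge_atTop (a + 1)),
    hlog.eventually (eventually_const_mul_pow_le_exp two_pos (2 * B) 0),
    hlog.eventually (eventually_const_mul_pow_le_exp one_pos (2 * D) 0)]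
    with ⟨N, δ⟩ hδ hexp hmid hL hLB hLD u
  simp only [pow_zero, mul_one, one_mul] at hδ hexp hmid hL hLB hLD ⊢
  set L := Real.log N
  rw [norm_fourierIntegrand]
  have hinv : 0 < (1 + u ^ 2)⁻¹ := by positivity
  have hsplit : ‖𝓕 F (δ * u)‖ * |cosProd N u| ≤ 96 * B * (1 + u ^ 2)⁻¹ ∨
      ‖𝓕 F (δ * u)‖ * |cosProd N u| ≤ (1 + u ^ 2)⁻¹ := by
    rcases le_or_gt (8 * |u|) N with h8 | h8
    · left
      have h1 := (abs_cosProd_le_exp h8).trans (exp_one_sub_div_four_le (abs_nonneg u))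
      rw [sq_abs] at h1
      calc _ ≤ B * (96 * (1 + u ^ 2)⁻¹) := by gcongr; exact hB _
        _ = _ := by ring
    right
    rcases le_or_gt |u| (Real.exp (a * L ^ 2)) with hU | hU
    · have h1 := hmid u h8 hU
      have h2 : u ^ 2 ≤ Real.exp (2 * (a * L ^ 2)) := by
        rw [← sq_abs, two_mul, Real.exp_add, ← sq]
        gcongr
      have h3 : 1 ≤ Real.exp (2 * (a * L ^ 2)) := Real.one_le_exp (by positivity)
      rw [← one_div, le_div_iff₀ (by positivity)]
      calc ‖𝓕 F (δ * u)‖ * |cosProd N u| * (1 + u ^ 2)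
          ≤ B * Real.exp (-2 * L ^ 3) * (2 * Real.exp (2 * (a * L ^ 2))) := by
            gcongr
            · exact hB _
            · linarith
        _ = 2 * B * Real.exp (-2 * L ^ 3 + 2 * (a * L ^ 2)) := by rw [Real.exp_add]; ring
        _ ≤ Real.exp (2 * L) * Real.exp (-2 * L ^ 3 + 2 * (a * L ^ 2)) := by gcongr
        _ = Real.exp (2 * L + (-2 * L ^ 3 + 2 * (a * L ^ 2))) := (Real.exp_add _ _).symm
        _ ≤ 1 := by
          rw [Real.exp_le_one_iff]
          have : 0 ≤ L ^ 2 * (L - (a + 1)) := mul_nonneg (sq_nonneg _) (by linarith)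
          nlinarith
    · have hU1 : 1 ≤ Real.exp (a * L ^ 2) := Real.one_le_exp (by positivity)
      have hu1 : 1 < |u| := hU1.trans_lt hU
      have hu2 : 1 ≤ u ^ 2 := by rw [← sq_abs]; exact one_le_pow₀ hu1.le
      have h1 := hD (δ * u)
      rw [norm_mul, Real.norm_eq_abs, Real.norm_eq_abs, abs_of_pos hδ, mul_pow, pow_add |u|,
        sq_abs] at h1
      have h2 : 2 * D ≤ δ ^ (j + 2) * |u| ^ j := by
        calc 2 * D ≤ Real.exp L := hLD
          _ ≤ Real.exp ((j + 2 : ℕ) * (-C * L ^ 2) + j * (a * L ^ 2)) := by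
            apply Real.exp_le_exp.2
            push_cast
            have : 0 ≤ L ^ 2 * (j * (a - C) - (1 + 2 * C)) :=
              mul_nonneg (sq_nonneg _) (by linarith)
            nlinarith
          _ = Real.exp (-C * L ^ 2) ^ (j + 2) * Real.exp (a * L ^ 2) ^ j := by
            rw [Real.exp_add, Real.exp_nat_mul, Real.exp_nat_mul]
          _ ≤ _ := by gcongr
      have hcos := abs_cosProd_le_one N u
      have h3 : ‖𝓕 F (δ * u)‖ * (2 * u ^ 2) ≤ 1 := by
        have hn := norm_nonneg (𝓕 F (δ * u))
        have : ‖𝓕 F (δ * u)‖ * (2 * u ^ 2) * D ≤ 1 * D := by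
          calc ‖𝓕 F (δ * u)‖ * (2 * u ^ 2) * D = ‖𝓕 F (δ * u)‖ * u ^ 2 * (2 * D) := by ring
            _ ≤ ‖𝓕 F (δ * u)‖ * u ^ 2 * (δ ^ (j + 2) * |u| ^ j) := by gcongr
            _ = δ ^ (j + 2) * (|u| ^ j * u ^ 2) * ‖𝓕 F (δ * u)‖ := by ring
            _ ≤ 1 * D := by rw [one_mul]; exact h1
        exact le_of_mul_le_mul_right this hD0
      rw [← one_div, le_div_iff₀ (by positivity)]
      calc ‖𝓕 F (δ * u)‖ * |cosProd N u| * (1 + u ^ 2)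
          ≤ ‖𝓕 F (δ * u)‖ * 1 * (2 * u ^ 2) := by gcongr; linarith
        _ ≤ 1 := by rw [mul_one]; exact h3
  rcases hsplit with h | h
  · linarith
  · have : 0 ≤ 96 * B * (1 + u ^ 2)⁻¹ := by positivity
    linarith

theorem integral_cos_mul_tprod_cos (τ : ℝ) :
    ∫ u : ℝ, Real.cos (2 * Real.pi * u * τ) *
      ∏' n : ℕ, Real.cos (2 * Real.pi * u / ((n : ℝ) + 1)) = harmonicDensity τ := by
  rw [harmonicDensity, ← integral_comp_abs]
  congr 1
  ext u
  rcases abs_choice u with h | h <;> rw [h]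
  simp [neg_div]

/-- Pointwise, the transform at `δu` tends to its value `∫ f` at 0 and `cosProd` to the infinite
product; the real part of the exponential is the cosine in `g`. -/
theorem tendsto_sum_div_logSqFilter {C : ℝ} (hC0 : 0 < C) (hC : C < 1 / Real.log 4) (τ : ℝ)
    {f : ℝ → ℝ} (hf : HasCompactSupport f) (hf' : ContDiff ℝ ∞ f) :
    Tendsto (fun p : ℕ × ℝ =>
      (∑ s : Fin p.1 → ℤˣ, f ((signedHarmonicSum s - τ) / p.2)) / (2 ^ p.1 * p.2))
      (logSqFilter C) (𝓝 ((∫ x, f x) * harmonicDensity τ)) := by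
  have hg : HasCompactSupport fun x => (f x : ℂ) := hf.comp_left Complex.ofReal_zero
  have hg' : ContDiff ℝ ∞ fun x => (f x : ℂ) := Complex.ofRealCLM.contDiff.comp hf'
  set F : 𝓢(ℝ, ℂ) := hg.toSchwartzMap hg' with hFdef
  have hF : ∀ x, F x = (f x : ℂ) := fun x => rfl
  have hF0 : 𝓕 F 0 = ((∫ x, f x : ℝ) : ℂ) := by
    rw [SchwartzMap.fourier_coe, Real.fourier_real_eq_integral_exp_smul]
    simp [hF, integral_complex_ofReal]
  obtain ⟨B, hB⟩ := eventually_norm_fourierIntegrand_le hC0 hC F τ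
  have hlim : Tendsto (fun p : ℕ × ℝ => ∫ u, (fourierIntegrand F τ p.1 p.2 u).re)
      (logSqFilter C) (𝓝 (∫ u : ℝ, (∫ x, f x) * (Real.cos (2 * Real.pi * u * τ) *
        ∏' n : ℕ, Real.cos (2 * Real.pi * u / ((n : ℝ) + 1))))) := by
    refine tendsto_integral_filter_of_dominated_convergence (fun u => B * (1 + u ^ 2)⁻¹)
      (Eventually.of_forall fun p => ?_) ?_ (integrable_inv_one_add_sq.const_mul B)
      (Eventually.of_forall fun u => ?_)
    · exact (Complex.continuous_re.comp
        (continuous_fourierIntegrand F τ p.1 p.2)).aestronglyMeasurable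
    · filter_upwards [hB] with p hp
      exact Eventually.of_forall fun u => (Complex.abs_re_le_norm _).trans (hp u)
    · have h1 : Tendsto (fun p : ℕ × ℝ => 𝓕 F (p.2 * u)) (logSqFilter C) (𝓝 (𝓕 F 0)) := by
        have h2 : Tendsto (fun p : ℕ × ℝ => p.2 * u) (logSqFilter C) (𝓝 0) := by
          have := ((tendsto_snd_logSqFilter C).mono_right nhdsWithin_le_nhds).mul_const u
          simpa using this
        exact ((𝓕 F).continuous.tendsto 0).comp h2
      have h3 : Tendsto (fun p : ℕ × ℝ => (cosProd p.1 u : ℂ)) (logSqFilter C) (𝓝 _) :=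
        (Complex.continuous_ofReal.tendsto _).comp
          ((tendsto_cosProd u).comp (tendsto_fst_logSqFilter C))
      have h4 := (Complex.continuous_re.tendsto _).comp ((h1.mul_const
        (Complex.exp ((-(2 * Real.pi * u * τ) : ℝ) * Complex.I))).mul h3)
      refine h4.congr' (Eventually.of_forall fun p => rfl) |>.trans_eq ?_
      rw [hF0, Complex.re_mul_ofReal, Complex.re_ofReal_mul, Complex.exp_ofReal_mul_I_re,
        Real.cos_neg, mul_assoc]
  rw [integral_const_mul, integral_cos_mul_tprod_cos] at hlim
  refine hlim.congr' ?_
  filter_upwards [(tendsto_snd_logSqFilter C).eventually self_mem_nhdsWithin] with p hp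
  have hp' : 0 < p.2 := hp
  have h1 := sum_schwartz_eq_integral F τ p.1 hp'
  have h2 := integral_re (integrable_fourierIntegrand F τ p.1 hp'.ne')
  have h3 : ∑ s : Fin p.1 → ℤˣ, f ((signedHarmonicSum s - τ) / p.2) =
      2 ^ p.1 * p.2 * ∫ u, (fourierIntegrand F τ p.1 p.2 u).re := by
    have h4 := congrArg Complex.re h1
    simp only [hF] at h4
    rw [← Complex.ofReal_sum, Complex.ofReal_re] at h4
    rw [h4]
    have h5 : (2 ^ p.1 * (p.2 : ℂ)) = ((2 ^ p.1 * p.2 : ℝ) : ℂ) := by push_cast; rfl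
    rw [h5, Complex.re_ofReal_mul]
    congr 1
    exact h2.symm
  rw [h3, mul_div_cancel_left₀ _ (by positivity)]

/-! ### Greedy choice of signs and a lower bound for the count -/

theorem exists_unit_abs_sub_eq (r a : ℝ) : ∃ σ : ℤˣ, |r - ((σ : ℤ) : ℝ) * a| = |(|r| - a)| := by
  rcases le_or_gt 0 r with h | h
  · exact ⟨1, by simp [abs_of_nonneg h]⟩
  · refine ⟨-1, ?_⟩
    rw [abs_of_neg h, ← abs_neg]
    congr 1
    push_cast
    ring

/-- Always step towards 0: the remainder shrinks by `a i` until a step overshoots, and an overshoot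
is at most `η`. -/
theorem exists_signs_abs_sub_sum_le {ι : Type*} {a : ι → ℝ} {η : ℝ} (S : Finset ι)
    (h0 : ∀ i ∈ S, 0 ≤ a i) (hη : ∀ i ∈ S, a i ≤ η) (y : ℝ) :
    ∃ s : ι → ℤˣ, |y - ∑ i ∈ S, ((s i : ℤ) : ℝ) * a i| ≤ max η (|y| - ∑ i ∈ S, a i) := by
  classical
  induction S using Finset.induction_on with
  | empty => exact ⟨1, by simp⟩
  | insert i S hi ih =>
    obtain ⟨s, hs⟩ := ih (fun j hj => h0 j (mem_insert_of_mem hj))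
      (fun j hj => hη j (mem_insert_of_mem hj))
    obtain ⟨σ, hσ⟩ := exists_unit_abs_sub_eq (y - ∑ i ∈ S, ((s i : ℤ) : ℝ) * a i) (a i)
    refine ⟨Function.update s i σ, ?_⟩
    have e : ∑ j ∈ S, ((Function.update s i σ j : ℤ) : ℝ) * a j =
        ∑ j ∈ S, ((s j : ℤ) : ℝ) * a j := by
      refine sum_congr rfl fun j hj => ?_
      rw [Function.update_of_ne (by rintro rfl; exact hi hj)]
    rw [sum_insert hi, sum_insert hi, e, Function.update_self, add_comm, ← sub_sub, hσ]
    have ha0 := h0 i (mem_insert_self i S)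
    have haη := hη i (mem_insert_self i S)
    have hr := abs_nonneg (y - ∑ i ∈ S, ((s i : ℤ) : ℝ) * a i)
    rw [abs_le]
    rw [le_max_iff] at hs
    constructor
    · have := le_max_left η (|y| - (a i + ∑ i ∈ S, a i))
      linarith
    · rw [le_max_iff]
      rcases hs with hs | hs
      · left; linarith
      · right; linarith

/-- The indices `2^k - 1`, `1 ≤ k ≤ J`, of the terms `1/2^k` of the harmonic series. -/
def dyadicIndices (J : ℕ) : Finset ℕ :=
  (range J).image fun k => 2 ^ (k + 1) - 1

theorem injective_two_pow_sub_one : Function.Injective fun k : ℕ => 2 ^ (k + 1) - 1 := by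
  intro j k h
  have hj : 0 < 2 ^ (j + 1) := by positivity
  have hk : 0 < 2 ^ (k + 1) := by positivity
  have h' : 2 ^ (j + 1) = 2 ^ (k + 1) := by
    simp only at h
    omega
  have := Nat.pow_right_injective le_rfl h'
  omega

theorem cast_two_pow_sub_one_add_one (k : ℕ) :
    ((2 ^ (k + 1) - 1 : ℕ) : ℝ) + 1 = 2 ^ (k + 1) := by
  rw [Nat.cast_sub Nat.one_le_two_pow]
  push_cast
  ring

theorem dyadicIndices_succ (J : ℕ) :
    dyadicIndices (J + 1) = insert (2 ^ (J + 1) - 1) (dyadicIndices J) := by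
  rw [dyadicIndices, range_add_one, image_insert, dyadicIndices]

theorem notMem_dyadicIndices (J : ℕ) : 2 ^ (J + 1) - 1 ∉ dyadicIndices J := by
  intro h
  rw [dyadicIndices, mem_image] at h
  obtain ⟨k, hk, h⟩ := h
  have := injective_two_pow_sub_one h
  simp at hk
  omega

theorem sum_dyadicIndices (J : ℕ) :
    ∑ n ∈ dyadicIndices J, 1 / ((n : ℝ) + 1) = 1 - 1 / 2 ^ J := by
  induction J with
  | zero => simp [dyadicIndices]
  | succ J ih =>
    rw [dyadicIndices_succ, sum_insert (notMem_dyadicIndices J), ih,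
      cast_two_pow_sub_one_add_one, pow_succ]
    field_simp
    ring

/-- A remainder of size at most `2 · 2^-(J+1)`, moved by `2^-(J+1)` towards 0, is at most
`2^-(J+1)`. -/
theorem exists_signs_dyadicIndices (J : ℕ) {y : ℝ} (hy : |y| ≤ 1) :
    ∃ s : ℕ → ℤˣ, |y - ∑ n ∈ dyadicIndices J, ((s n : ℤ) : ℝ) * (1 / ((n : ℝ) + 1))| ≤
      1 / 2 ^ J := by
  induction J with
  | zero => exact ⟨1, by simpa [dyadicIndices] using hy⟩
  | succ J ih =>
    obtain ⟨s, hs⟩ := ih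
    have hn := notMem_dyadicIndices J
    set n := 2 ^ (J + 1) - 1 with hndef
    obtain ⟨σ, hσ⟩ := exists_unit_abs_sub_eq
      (y - ∑ n ∈ dyadicIndices J, ((s n : ℤ) : ℝ) * (1 / ((n : ℝ) + 1))) (1 / ((n : ℝ) + 1))
    refine ⟨Function.update s n σ, ?_⟩
    have e : ∑ j ∈ dyadicIndices J, ((Function.update s n σ j : ℤ) : ℝ) * (1 / ((j : ℝ) + 1)) =
        ∑ j ∈ dyadicIndices J, ((s j : ℤ) : ℝ) * (1 / ((j : ℝ) + 1)) := by
      refine sum_congr rfl fun j hj => ?_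
      rw [Function.update_of_ne (by rintro rfl; exact hn hj)]
    rw [dyadicIndices_succ, ← hndef, sum_insert hn, e, Function.update_self, add_comm, ← sub_sub,
      hσ, hndef, cast_two_pow_sub_one_add_one, abs_le]
    have h2 : (1 : ℝ) / 2 ^ J = 2 * (1 / 2 ^ (J + 1)) := by rw [pow_succ]; field_simp
    have hr := abs_nonneg (y - ∑ n ∈ dyadicIndices J, ((s n : ℤ) : ℝ) * (1 / ((n : ℝ) + 1)))
    constructor <;> linarith

/-- The non-dyadic indices below `M` bring the remainder down to 1, then the dyadic ones refine it.
The extra 1 in `hM` pays for the dyadic terms, whose sum is below 1. -/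
theorem exists_signs_range_union_dyadicIndices {M : ℕ} {A : ℝ}
    (hM : A + 1 ≤ ∑ n ∈ range M, 1 / ((n : ℝ) + 1)) (J : ℕ) {y : ℝ} (hy : |y| ≤ A) :
    ∃ s : ℕ → ℤˣ, |y - ∑ n ∈ range M ∪ dyadicIndices J, ((s n : ℤ) : ℝ) * (1 / ((n : ℝ) + 1))| ≤
      1 / 2 ^ J := by
  classical
  have hsum : A ≤ ∑ n ∈ range M \ dyadicIndices J, 1 / ((n : ℝ) + 1) := by
    have h1 : ∑ n ∈ range M, 1 / ((n : ℝ) + 1) ≤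
        ∑ n ∈ range M \ dyadicIndices J ∪ dyadicIndices J, 1 / ((n : ℝ) + 1) := by
      apply sum_le_sum_of_subset_of_nonneg
      · rw [sdiff_union_self_eq_union]; exact subset_union_left
      · intros; positivity
    rw [sum_union sdiff_disjoint, sum_dyadicIndices] at h1
    have : (0 : ℝ) ≤ 1 / 2 ^ J := by positivity
    linarith
  obtain ⟨s, hs⟩ := exists_signs_abs_sub_sum_le (a := fun n : ℕ => 1 / ((n : ℝ) + 1)) (η := 1)
    (range M \ dyadicIndices J) (fun n _ => by positivity)
    (fun n _ => by
      rw [div_le_one (by positivity)]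
      have : (0 : ℝ) ≤ n := by positivity
      linarith) y
  have hs1 := hs.trans (max_le le_rfl (by linarith))
  obtain ⟨t, ht⟩ := exists_signs_dyadicIndices J hs1
  refine ⟨fun n => if n ∈ dyadicIndices J then t n else s n, ?_⟩
  rw [← sdiff_union_self_eq_union, sum_union sdiff_disjoint, ← sub_sub]
  convert ht using 3
  · congr 1
    refine sum_congr rfl fun n hn => ?_
    simp only [if_neg (mem_sdiff.1 hn).2]
  · refine sum_congr rfl fun n hn => ?_
    simp only [if_pos hn]

theorem sum_signs_exp (N : ℕ) (b : Fin N → ℝ) :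
    ∑ s : Fin N → ℤˣ, Real.exp (∑ i, ((s i : ℤ) : ℝ) * b i) ≤
      2 ^ N * Real.exp (∑ i, b i ^ 2 / 2) := by
  simp_rw [Real.exp_sum]
  rw [← Fintype.prod_sum (fun (i : Fin N) (σ : ℤˣ) => Real.exp (((σ : ℤ) : ℝ) * b i))]
  calc _ ≤ ∏ i : Fin N, 2 * Real.exp (b i ^ 2 / 2) := by
        refine prod_le_prod (fun _ _ => sum_nonneg fun _ _ => (Real.exp_pos _).le) fun i _ => ?_
        rw [UnitsInt.univ, sum_pair (by decide)]
        have := Real.cosh_le_exp_half_sq (b i)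
        rw [Real.cosh_eq] at this
        push_cast
        simp only [one_mul, neg_mul]
        linarith
    _ = _ := by rw [prod_mul_distrib, prod_const, card_univ, Fintype.card_fin]

/-- Chernoff's bound with parameter 2: the proportion is at most `exp (1/4 - 2) ≤ 1/4`. -/
theorem card_one_lt_sum_signs_le {N : ℕ} {b : Fin N → ℝ} (hb : ∑ i, b i ^ 2 ≤ 1 / 8) :
    (#{s : Fin N → ℤˣ | 1 < ∑ i, ((s i : ℤ) : ℝ) * b i} : ℝ) ≤ 2 ^ N / 4 := by
  have h1 := sum_signs_exp N (fun i => 2 * b i)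
  have h2 : ∑ i, (2 * b i) ^ 2 / 2 ≤ 1 / 4 := by
    calc ∑ i, (2 * b i) ^ 2 / 2 = 2 * ∑ i, b i ^ 2 := by
          rw [mul_sum]; exact sum_congr rfl fun i _ => by ring
      _ ≤ _ := by linarith
  have h3 : (#{s : Fin N → ℤˣ | 1 < ∑ i, ((s i : ℤ) : ℝ) * b i} : ℝ) * Real.exp 2 ≤
      ∑ s : Fin N → ℤˣ, Real.exp (∑ i, ((s i : ℤ) : ℝ) * (2 * b i)) := by
    rw [← nsmul_eq_mul, ← sum_const]
    refine (sum_le_sum fun s hs => ?_).trans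
      (sum_le_sum_of_subset_of_nonneg (subset_univ _) fun _ _ _ => (Real.exp_pos _).le)
    apply Real.exp_le_exp.2
    have hs' := (mem_filter.1 hs).2
    have : ∑ i, ((s i : ℤ) : ℝ) * (2 * b i) = 2 * ∑ i, ((s i : ℤ) : ℝ) * b i := by
      rw [mul_sum]; exact sum_congr rfl fun i _ => by ring
    linarith
  have h4 : Real.exp (∑ i, (2 * b i) ^ 2 / 2) ≤ Real.exp (1 / 4) := Real.exp_le_exp.2 h2
  have h5 : 4 * Real.exp (1 / 4) ≤ Real.exp 2 := by
    have := Real.quadratic_le_exp_of_nonneg (by norm_num : (0 : ℝ) ≤ 7 / 4)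
    calc 4 * Real.exp (1 / 4) ≤ Real.exp (7 / 4) * Real.exp (1 / 4) := by
          gcongr; norm_num at this; linarith
      _ = Real.exp 2 := by rw [← Real.exp_add]; norm_num
  have h6 : (#{s : Fin N → ℤˣ | 1 < ∑ i, ((s i : ℤ) : ℝ) * b i} : ℝ) * (4 * Real.exp (1 / 4)) ≤
      2 ^ N * Real.exp (1 / 4) := by
    calc _ ≤ _ * Real.exp 2 := by gcongr
      _ ≤ _ := h3.trans h1
      _ ≤ _ := by gcongr
  have h7 := Real.exp_pos (1 / 4)
  rw [← mul_assoc] at h6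
  have := le_of_mul_le_mul_right h6 h7
  linarith

theorem half_le_card_abs_sum_signs_le_one {N : ℕ} {b : Fin N → ℝ} (hb : ∑ i, b i ^ 2 ≤ 1 / 8) :
    (2 : ℝ) ^ N / 2 ≤ #{s : Fin N → ℤˣ | |∑ i, ((s i : ℤ) : ℝ) * b i| ≤ 1} := by
  have h1 := card_one_lt_sum_signs_le hb
  have h2 := card_one_lt_sum_signs_le (b := fun i => -b i) (by simpa using hb)
  have h3 : (univ : Finset (Fin N → ℤˣ)) ⊆
      ({s : Fin N → ℤˣ | |∑ i, ((s i : ℤ) : ℝ) * b i| ≤ 1} : Finset _) ∪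
      (({s : Fin N → ℤˣ | 1 < ∑ i, ((s i : ℤ) : ℝ) * b i} : Finset _) ∪
        ({s : Fin N → ℤˣ | 1 < ∑ i, ((s i : ℤ) : ℝ) * (-b i)} : Finset _)) := by
    intro s _
    simp only [mem_union, mem_filter, mem_univ, true_and, mul_neg, sum_neg_distrib]
    by_contra! h
    have := abs_le.2 ⟨by linarith [h.2.2], h.2.1⟩
    linarith [h.1]
  have h4 := (card_le_card h3).trans (card_union_le _ _)
  have h5 := card_union_le ({s : Fin N → ℤˣ | 1 < ∑ i, ((s i : ℤ) : ℝ) * b i} : Finset _)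
    {s : Fin N → ℤˣ | 1 < ∑ i, ((s i : ℤ) : ℝ) * (-b i)}
  have h6 : #(univ : Finset (Fin N → ℤˣ)) = 2 ^ N := by simp
  rw [h6] at h4
  have h7 := h4.trans (Nat.add_le_add_left h5 _)
  have h8 : (2 : ℝ) ^ N ≤ #{s : Fin N → ℤˣ | |∑ i, ((s i : ℤ) : ℝ) * b i| ≤ 1} +
      (#{s : Fin N → ℤˣ | 1 < ∑ i, ((s i : ℤ) : ℝ) * b i} +
      #{s : Fin N → ℤˣ | 1 < ∑ i, ((s i : ℤ) : ℝ) * (-b i)}) := by exact_mod_cast h7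
  linarith

/-- The signs outside a set `E` of at most `M + J` indices contribute at most 1 in absolute value
for at least half of the sign vectors; the signs on `E` can then be reset to come within `δ` of `τ`.
Each resulting vector arises from at most `2^(M+J)` originals. -/
theorem two_pow_le_signCount_mul (τ : ℝ) :
    ∃ M : ℕ, ∀ (J N : ℕ) (δ : ℝ), 1 / 2 ^ J < δ → M ≤ N → 2 ^ J ≤ N →
      (2 : ℝ) ^ N / 2 ≤ signCount N τ δ * 2 ^ (M + J) := by
  classical
  have hdiv : Tendsto (fun M : ℕ => ∑ n ∈ range M, 1 / ((n : ℝ) + 1)) atTop atTop :=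
    Real.tendsto_sum_range_one_div_nat_succ_atTop
  -- One unit is for the random tail, the other for the dyadic terms; `M ≥ 8` makes the tail of `∑
  -- 1/n²` at most `1/8`.
  obtain ⟨M, hM, hM8⟩ := ((hdiv.eventually (eventually_ge_atTop (|τ| + 1 + 1))).and
    (eventually_ge_atTop 8)).exists
  refine ⟨M, fun J N δ hδ hMN hJN => ?_⟩
  set E := range M ∪ dyadicIndices J with hE
  have hEN : E ⊆ range N := by
    refine union_subset (range_subset_range.2 hMN) fun n hn => ?_
    rw [dyadicIndices, mem_image] at hn
    obtain ⟨k, hk, rfl⟩ := hn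
    have hk' : k + 1 ≤ J := by simpa using hk
    have h1 : 2 ^ (k + 1) ≤ 2 ^ J := Nat.pow_le_pow_right two_pos hk'
    have h2 : 0 < 2 ^ (k + 1) := by positivity
    rw [mem_range]; omega
  set b : Fin N → ℝ := fun i => if (i : ℕ) ∈ E then 0 else 1 / ((i : ℝ) + 1) with hb
  have hb8 : ∑ i, b i ^ 2 ≤ 1 / 8 := by
    have h1 : ∑ i, b i ^ 2 ≤
        ∑ i : Fin N, if M ≤ (i : ℕ) then ((((i : ℕ) + 1 : ℕ) : ℝ) ^ 2)⁻¹ else 0 := by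
      refine sum_le_sum fun i _ => ?_
      by_cases hi : (i : ℕ) ∈ E
      · simp only [hb, if_pos hi]
        split_ifs
        · rw [zero_pow two_ne_zero]; positivity
        · simp
      · have hi' : M ≤ (i : ℕ) := by
          by_contra h
          exact hi (mem_union_left _ (mem_range.2 (by omega)))
        simp only [hb, if_neg hi, if_pos hi']
        push_cast
        simp
    rw [Fin.sum_univ_eq_sum_range
      (fun n => if M ≤ n then (((n + 1 : ℕ) : ℝ) ^ 2)⁻¹ else 0) N, ← sum_filter] at h1
    have h2 : ∑ n ∈ range N with M ≤ n, (((n + 1 : ℕ) : ℝ) ^ 2)⁻¹ =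
        ∑ n ∈ Ioc M N, ((n : ℝ) ^ 2)⁻¹ := by
      refine sum_bij (fun n _ => n + 1) ?_ ?_ ?_ ?_
      · intro n hn; simp at hn ⊢; omega
      · intro n _ m _ h; omega
      · intro n hn
        simp only [mem_Ioc] at hn
        exact ⟨n - 1, by simp; omega, by omega⟩
      · intros; rfl
    have h3 := sum_Ioc_inv_sq_le_sub (α := ℝ) (by omega : M ≠ 0) hMN
    have h4 : ((M : ℝ))⁻¹ ≤ 1 / 8 := by
      rw [← one_div]
      have : (8 : ℝ) ≤ M := by exact_mod_cast hM8
      gcongr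
    have h5 : (0 : ℝ) ≤ (N : ℝ)⁻¹ := by positivity
    linarith
  refine (half_le_card_abs_sum_signs_le_one hb8).trans ?_
  have hex : ∀ s : Fin N → ℤˣ, |∑ i, ((s i : ℤ) : ℝ) * b i| ≤ 1 → ∃ t : ℕ → ℤˣ,
      |τ - ∑ i, ((s i : ℤ) : ℝ) * b i - ∑ n ∈ E, ((t n : ℤ) : ℝ) * (1 / ((n : ℝ) + 1))| < δ := by
    intro s hs
    have h1 : |τ - ∑ i, ((s i : ℤ) : ℝ) * b i| ≤ |τ| + 1 := (abs_sub _ _).trans (by linarith)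
    obtain ⟨t, ht⟩ := exists_signs_range_union_dyadicIndices hM J h1
    exact ⟨t, ht.trans_lt hδ⟩
  choose! t ht using hex
  set φ : (Fin N → ℤˣ) → (Fin N → ℤˣ) := fun s i => if (i : ℕ) ∈ E then t s i else s i with hφ
  have hsum : ∀ s, signedHarmonicSum (φ s) = ∑ i, ((s i : ℤ) : ℝ) * b i +
      ∑ n ∈ E, ((t s n : ℤ) : ℝ) * (1 / ((n : ℝ) + 1)) := by
    intro s
    have h1 : ∑ n ∈ E, ((t s n : ℤ) : ℝ) * (1 / ((n : ℝ) + 1)) =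
        ∑ i : Fin N, if (i : ℕ) ∈ E then ((t s i : ℤ) : ℝ) * (1 / (((i : ℕ) : ℝ) + 1)) else 0 := by
      rw [Fin.sum_univ_eq_sum_range
        (fun n => if n ∈ E then ((t s n : ℤ) : ℝ) * (1 / ((n : ℝ) + 1)) else 0) N, ← sum_filter,
        filter_mem_eq_inter, inter_eq_right.2 hEN]
    rw [h1, ← sum_add_distrib, signedHarmonicSum]
    refine sum_congr rfl fun i _ => ?_
    by_cases hi : (i : ℕ) ∈ E <;> simp [hφ, hb, hi, div_eq_mul_inv]
  have hcard : #{s : Fin N → ℤˣ | |∑ i, ((s i : ℤ) : ℝ) * b i| ≤ 1} ≤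
      #(({s : Fin N → ℤˣ | |τ - signedHarmonicSum s| < δ} : Finset _) ×ˢ
        (univ : Finset (E → ℤˣ))) := by
    -- Remembering the overwritten signs on `E` makes the correction injective.
    refine card_le_card_of_injOn
      (fun s => (φ s, fun e => s ⟨e, mem_range.1 (hEN e.2)⟩)) ?_ ?_
    · intro s hs
      have hs' : |∑ i, ((s i : ℤ) : ℝ) * b i| ≤ 1 := by simpa using hs
      have := ht s hs'
      simp only [coe_product, Set.mem_prod, coe_univ, Set.mem_univ, and_true, mem_coe, mem_filter,
        mem_univ, true_and, hsum]
      rwa [← sub_sub]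
    · intro s _ s' _ h
      rw [Prod.mk.injEq] at h
      ext1 i
      by_cases hi : (i : ℕ) ∈ E
      · exact congrFun h.2 ⟨i, hi⟩
      · have := congrFun h.1 i
        simpa [hφ, hi] using this
  rw [card_product] at hcard
  have hEcard : #(univ : Finset (E → ℤˣ)) ≤ 2 ^ (M + J) := by
    have h1 : #E ≤ M + J := (card_union_le _ _).trans
      (by simpa [dyadicIndices] using
        card_image_le (s := range J) (f := fun k => 2 ^ (k + 1) - 1))
    simpa using Nat.pow_le_pow_right two_pos h1
  have := hcard.trans (Nat.mul_le_mul_left _ hEcard)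
  exact_mod_cast this

theorem exists_pos_mul_le_signCount (τ : ℝ) :
    ∃ c : ℝ, 0 < c ∧ ∀ δ : ℝ, 0 < δ → δ < 1 →
      ∀ᶠ N : ℕ in atTop, c * δ * 2 ^ N ≤ signCount N τ δ := by
  obtain ⟨M, hM⟩ := two_pow_le_signCount_mul τ
  refine ⟨1 / (4 * 2 ^ M), by positivity, fun δ h0 h1 => ?_⟩
  obtain ⟨J, hJ1, hJ2⟩ := exists_nat_pow_near_of_lt_one h0 h1.le
    (by norm_num : (0 : ℝ) < 1 / 2) (by norm_num)
  rw [div_pow, one_pow] at hJ1 hJ2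
  filter_upwards [eventually_ge_atTop M, eventually_ge_atTop (2 ^ (J + 1))] with N hN1 hN2
  have key := hM (J + 1) N δ hJ1 hN1 hN2
  rw [le_div_iff₀ (by positivity)] at hJ2
  have h2 : (0 : ℝ) ≤ signCount N τ δ := by positivity
  rw [one_div, inv_mul_eq_div, div_mul_eq_mul_div, div_le_iff₀ (by positivity)]
  calc δ * 2 ^ N = 2 * δ * (2 ^ N / 2) := by ring
    _ ≤ 2 * δ * (signCount N τ δ * 2 ^ (M + (J + 1))) := by gcongr
    _ = signCount N τ δ * (4 * 2 ^ M) * (δ * 2 ^ J) := by ring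
    _ ≤ signCount N τ δ * (4 * 2 ^ M) * 1 := by gcongr
    _ = _ := mul_one _

/-! ### Positivity of the density and the sharp count -/

theorem exists_of_eventually_logSqFilter {C : ℝ} {P : ℕ → ℝ → Prop}
    (h : ∀ᶠ p in logSqFilter C, P p.1 p.2) :
    ∃ N₀ : ℕ, ∃ δ₀ : ℝ, 0 < δ₀ ∧ ∀ N : ℕ, N₀ ≤ N → ∀ δ : ℝ,
      Real.exp (-C * Real.log N ^ 2) ≤ δ → δ < δ₀ → P N δ := by
  rw [logSqFilter, eventually_inf_principal,
    (atTop_basis.prod (nhdsGT_basis (0 : ℝ))).eventually_iff] at h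
  obtain ⟨⟨N₀, δ₀⟩, ⟨-, hδ₀⟩, h⟩ := h
  exact ⟨N₀, δ₀, hδ₀, fun N hN δ h1 h2 =>
    h (x := (N, δ)) ⟨hN, (Real.exp_pos _).trans_le h1, h2⟩ h1⟩

theorem tendsto_exp_neg_log_sq {C : ℝ} (hC : 0 < C) :
    Tendsto (fun N : ℕ => Real.exp (-C * Real.log N ^ 2)) atTop (𝓝 0) := by
  refine Real.tendsto_exp_atBot.comp ?_
  have h := (tendsto_pow_atTop (two_ne_zero (α := ℕ))).comp
    (Real.tendsto_log_atTop.comp tendsto_natCast_atTop_atTop)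
  exact h.const_mul_atTop_of_neg (neg_lt_zero.2 hC)

theorem signCount_eq_sum (N : ℕ) (τ δ : ℝ) :
    (signCount N τ δ : ℝ) =
      ∑ s : Fin N → ℤˣ, if |τ - signedHarmonicSum s| < δ then 1 else 0 := by
  rw [signCount, sum_boole]

theorem abs_sub_lt_iff_mem_ball {x τ δ : ℝ} (hδ : 0 < δ) :
    |τ - x| < δ ↔ (x - τ) / δ ∈ Metric.ball (0 : ℝ) 1 := by
  rw [mem_ball_zero_iff, Real.norm_eq_abs, abs_div, abs_of_pos hδ, div_lt_one hδ, abs_sub_comm]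

theorem signCount_le_sum_bump (f : ContDiffBump (0 : ℝ)) (hf : 1 ≤ f.rIn) (N : ℕ) (τ : ℝ) {δ : ℝ}
    (hδ : 0 < δ) :
    (signCount N τ δ : ℝ) ≤ ∑ s : Fin N → ℤˣ, f ((signedHarmonicSum s - τ) / δ) := by
  rw [signCount_eq_sum]
  refine sum_le_sum fun s _ => ?_
  split_ifs with h
  · rw [abs_sub_lt_iff_mem_ball hδ] at h
    exact (f.one_of_mem_closedBall
      (Metric.ball_subset_closedBall.trans (Metric.closedBall_subset_closedBall hf) h)).ge
  · exact f.nonneg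

theorem sum_bump_le_signCount (f : ContDiffBump (0 : ℝ)) (hf : f.rOut ≤ 1) (N : ℕ) (τ : ℝ) {δ : ℝ}
    (hδ : 0 < δ) :
    ∑ s : Fin N → ℤˣ, f ((signedHarmonicSum s - τ) / δ) ≤ (signCount N τ δ : ℝ) := by
  rw [signCount_eq_sum]
  refine sum_le_sum fun s _ => ?_
  split_ifs with h
  · exact f.le_one
  · rw [abs_sub_lt_iff_mem_ball hδ, Metric.mem_ball, not_lt] at h
    exact (f.zero_of_le_dist (hf.trans h)).le

theorem integral_bump_le (f : ContDiffBump (0 : ℝ)) : ∫ x, f x ≤ 2 * f.rOut := by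
  have h := f.integral_le_measure_closedBall (μ := volume)
  rwa [Real.volume_real_closedBall f.rOut_pos.le] at h

theorem le_integral_bump (f : ContDiffBump (0 : ℝ)) : 2 * f.rIn ≤ ∫ x, f x := by
  have h := f.measure_closedBall_le_integral (μ := volume)
  rwa [Real.volume_real_closedBall f.rIn_pos.le] at h

theorem tendsto_sum_bump_div {C : ℝ} (hC0 : 0 < C) (hC : C < 1 / Real.log 4) (τ : ℝ)
    (f : ContDiffBump (0 : ℝ)) :
    Tendsto (fun p : ℕ × ℝ =>
      (∑ s : Fin p.1 → ℤˣ, f ((signedHarmonicSum s - τ) / p.2)) / (2 ^ p.1 * p.2))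
      (logSqFilter C) (𝓝 ((∫ x, f x) * harmonicDensity τ)) :=
  tendsto_sum_div_logSqFilter hC0 hC τ f.hasCompactSupport f.contDiff

/-- The smoothed count dominates the sharp one, hence `c δ 2^N` with `c > 0` independent of `δ`; so
the limit `(∫ f) g(τ)` is at least `c`. -/
theorem harmonicDensity_pos (τ : ℝ) : 0 < harmonicDensity τ := by
  have hl4 : 0 < 1 / Real.log 4 := one_div_pos.2 (Real.log_pos (by norm_num))
  obtain ⟨C, hC0, hC⟩ := exists_between hl4
  let f : ContDiffBump (0 : ℝ) := ⟨1, 2, one_pos, one_lt_two⟩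
  have hlim := tendsto_sum_bump_div hC0 hC τ f
  obtain ⟨c, hc, hcount⟩ := exists_pos_mul_le_signCount τ
  have hfreq : ∃ᶠ p in logSqFilter C, c ≤
      (∑ s : Fin p.1 → ℤˣ, f ((signedHarmonicSum s - τ) / p.2)) / (2 ^ p.1 * p.2) := by
    intro hev
    obtain ⟨N₀, δ₀, hδ₀, h⟩ := exists_of_eventually_logSqFilter (P := fun N δ => ¬ c ≤
      (∑ s : Fin N → ℤˣ, f ((signedHarmonicSum s - τ) / δ)) / (2 ^ N * δ)) hev
    -- With `δ` fixed and `N` large the constraint `δ ≥ exp (-C (log N)²)` holds, so the bound for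
    -- fixed `δ` contradicts `h`.
    have hδ : 0 < min δ₀ 1 / 2 := by positivity
    obtain ⟨N, ⟨h1, h2⟩, h3⟩ := ((((tendsto_exp_neg_log_sq hC0).eventually
      (ge_mem_nhds hδ)).and (eventually_ge_atTop N₀)).and (hcount _ hδ (by
        have := min_le_right δ₀ 1
        linarith))).exists
    refine h N h2 _ h1 (by have := min_le_left δ₀ 1; linarith) ?_
    rw [le_div_iff₀ (by positivity)]
    have := signCount_le_sum_bump f le_rfl N τ hδ
    linarith
  have h1 := ge_of_tendsto_of_frequently hlim hfreq
  have h2 : 0 < ∫ x, f x := by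
    have := le_integral_bump f
    linarith [f.rIn_pos]
  exact pos_of_mul_pos_right (hc.trans_le h1) h2.le

theorem eventually_abs_signCount_sub_le {C : ℝ} (hC0 : 0 < C) (hC : C < 1 / Real.log 4) (τ : ℝ)
    {ε : ℝ} (hε : 0 < ε) :
    ∀ᶠ p in logSqFilter C,
      |(signCount p.1 τ p.2 : ℝ) - 2 ^ (p.1 + 1) * harmonicDensity τ * p.2|
        ≤ ε * (2 ^ (p.1 + 1) * harmonicDensity τ * p.2) := by
  have hg := harmonicDensity_pos τ
  obtain ⟨η, hη0, hη⟩ := exists_between (lt_min hε one_pos)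
  have hηε : η < ε := hη.trans_le (min_le_left _ _)
  have hη1 : η < 1 := hη.trans_le (min_le_right _ _)
  -- Majorant and minorant of the indicator, with integrals at most `2(1 + η)` and at least `2(1 -
  -- η)`. Since `η < ε` and `g(τ) > 0`, the limits lie strictly within the allowed error.
  let f : ContDiffBump (0 : ℝ) := ⟨1, 1 + η, one_pos, by linarith⟩
  let k : ContDiffBump (0 : ℝ) := ⟨1 - η, 1, by linarith, by linarith⟩
  have hf : (∫ x, f x) * harmonicDensity τ < 2 * (1 + ε) * harmonicDensity τ := by
    have h : ∫ x, f x ≤ 2 * (1 + η) := integral_bump_le f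
    gcongr
    linarith
  have hk : 2 * (1 - ε) * harmonicDensity τ < (∫ x, k x) * harmonicDensity τ := by
    have h : 2 * (1 - η) ≤ ∫ x, k x := le_integral_bump k
    gcongr
    linarith
  filter_upwards [(tendsto_sum_bump_div hC0 hC τ f).eventually (gt_mem_nhds hf),
    (tendsto_sum_bump_div hC0 hC τ k).eventually (lt_mem_nhds hk),
    (tendsto_snd_logSqFilter C).eventually self_mem_nhdsWithin] with ⟨N, δ⟩ h1 h2 hδ
  have hδ' : 0 < δ := hδ
  simp only at h1 h2 ⊢
  rw [div_lt_iff₀ (by positivity)] at h1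
  rw [lt_div_iff₀ (by positivity)] at h2
  have h3 := signCount_le_sum_bump f le_rfl N τ hδ'
  have h4 := sum_bump_le_signCount k le_rfl N τ hδ'
  rw [abs_le, pow_succ]
  constructor <;> linarith

theorem minDist_lt_of_signCount_pos {N : ℕ} {τ δ : ℝ} (h : 0 < signCount N τ δ) :
    minDist N τ < δ := by
  obtain ⟨s, hs⟩ := card_pos.1 h
  rw [minDist, inf'_lt_iff]
  refine ⟨signedHarmonicSum s, mem_image_of_mem _ (mem_univ s), ?_⟩
  rw [abs_sub_comm]
  exact (mem_filter.1 hs).2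

theorem corollary3 (C : ℝ) (hC0 : 0 < C) (hC : C < 1 / Real.log 4) (τ : ℝ) :
    (∀ ε : ℝ, 0 < ε → ∃ N₀ : ℕ, ∃ δ₀ : ℝ, 0 < δ₀ ∧
      ∀ N : ℕ, N₀ ≤ N → ∀ δ : ℝ, Real.exp (-C * Real.log N ^ 2) ≤ δ → δ < δ₀ →
        |(signCount N τ δ : ℝ) - 2 ^ (N + 1) * harmonicDensity τ * δ|
          ≤ ε * (2 ^ (N + 1) * harmonicDensity τ * δ)) ∧
    (∃ N₀ : ℕ, ∀ N : ℕ, N₀ ≤ N → minDist N τ < Real.exp (-C * Real.log N ^ 2)) := by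
  have main : ∀ ε : ℝ, 0 < ε → ∃ N₀ : ℕ, ∃ δ₀ : ℝ, 0 < δ₀ ∧
      ∀ N : ℕ, N₀ ≤ N → ∀ δ : ℝ, Real.exp (-C * Real.log N ^ 2) ≤ δ → δ < δ₀ →
        |(signCount N τ δ : ℝ) - 2 ^ (N + 1) * harmonicDensity τ * δ|
          ≤ ε * (2 ^ (N + 1) * harmonicDensity τ * δ) := fun ε hε =>
    exists_of_eventually_logSqFilter (eventually_abs_signCount_sub_le hC0 hC τ hε)
  refine ⟨main, ?_⟩
  -- Any `ε < 1` leaves a positive count; it is applied at the endpoint `δ = exp (-C (log N)²)`.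
  obtain ⟨N₀, δ₀, hδ₀, h⟩ := main (1 / 2) (by norm_num)
  rw [← eventually_atTop]
  filter_upwards [eventually_ge_atTop N₀,
    (tendsto_exp_neg_log_sq hC0).eventually (gt_mem_nhds hδ₀)] with N hN1 hN2
  have h1 := (abs_le.1 (h N hN1 _ le_rfl hN2)).1
  have h2 : 0 < 2 ^ (N + 1) * harmonicDensity τ * Real.exp (-C * Real.log N ^ 2) := by
    have := harmonicDensity_pos τ
    positivity
  apply minDist_lt_of_signCount_pos
  have : (0 : ℝ) < signCount N τ (Real.exp (-C * Real.log N ^ 2)) := by linarith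
  exact_mod_cast this
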